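/- A parity game consists of a finite set $V$ of vertices, an edge relation $\to$ on $V$ in which every vertex has at least one successor, a priority function $\mathcal P:V\to\mathbb N$, and a partition $V=V_\Diamond\cup V_\square$ of the vertices between the players $\Diamond$ (even) and $\square$ (odd). A play is an infinite path $\pi=\pi_0\pi_1\pi_2\cdots$; it is won by $\Diamond$ if the least priority occurring infinitely often on it is even, and by $\square$ otherwise. A strategy of player $p$ is a partial function $\sigma:V^+\to V$ such that, whenever it is defined on a finite path $u_1\cdots u_n$, $u_n\in V_p$ and $u_n\to\sigma(u_1\cdots u_n)$; it is positional if it is given by a function $V_p\to V$ of the last vertex. $\mathrm{Plays}(\sigma,v)$ is the set of plays from $v$ that follow $\sigma$ after each of their prefixes on which $\sigma$ is defined. Let $d-1$ be the largest priority. Let $\mathbb M_{ext}$ consist of $\top$ and of the tuples $m\in\mathbb N^d$ (with components $m_0,\dots,m_{d-1}$) that are $0$ at even positions, ordered lexicographically with $\top$ as the greatest element, and let $\mathbb M\subseteq\mathbb M_{ext}$ consist of $\top$ and of those tuples with $m_i\le|\{u\in V:\mathcal P(u)=i\}|$ for all odd $i$. Let $<_i$ and $\le_i$ be the lexicographic comparison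 of the components $0,\dots,i$ only, with every tuple $<_i\top$ and $\top\le_i\top$. For $\rho:V\to\mathbb M$ and $v\to w$ let $\mathrm{Prog}(\rho,v,w)$ be the least $m\in\mathbb M$ such that $m\ge_{\mathcal P(v)}\rho(w)$ if $\mathcal P(v)$ is even, and such that $m>_{\mathcal P(v)}\rho(w)$ or $m=\rho(w)=\top$ if $\mathcal P(v)$ is odd. The function $\rho$ is a game parity progress measure if $\rho(v)\ge_{\mathcal P(v)}\mathrm{Prog}(\rho,v,w)$ holds for some successor $w$ of $v$, for each $v\in V_\Diamond$, and for all successors $w$ of $v$, for each $v\in V_\square$. Let $\overline\rho$ be the least game parity progress measure in the pointwise order. The value $\theta(\pi)\in\mathbb M_{ext}$ of a play $\pi$ is $\top$ if $\square$ wins $\pi$. If $\Diamond$ wins $\pi$, it is the tuple whose component at each odd position $i$ is the degree of the maximal $i$-dominated prefix of $\pi$ ($0$ if there is no $i$-dominated prefix), and whose components at even positions are $0$; here a stretch of $\pi$ is $i$-dominated if $i$ is the least priority in it, and its degree is then the number of occurrences of vertices of priority $i$ in it. Theorem. For every vertex $v$: 1. there is a (possibly history-dependent) strategy $\sigma_\square$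 of player $\square$ such that $\theta(\pi)\ge\overline\rho(v)$ for every $\pi\in\mathrm{Plays}(\sigma_\square,v)$; 2. there is a positional strategy $\sigma_\Diamond$ of player $\Diamond$ such that $\theta(\pi)\le\overline\rho(v)$ for every $\pi\in\mathrm{Plays}(\sigma_\Diamond,v)$. Hence $\overline\rho$ is the equilibrium valuation: $\overline\rho(v)$ is both the greatest $x\in\mathbb M_{ext}$ for which player $\square$ has a strategy $\sigma$ with $\theta(\pi)\ge x$ for all $\pi\in\mathrm{Plays}(\sigma,v)$, and the least $x\in\mathbb M_{ext}$ for which player $\Diamond$ has a (possibly history-dependent) strategy $\sigma$ with $\theta(\pi)\le x$ for all $\pi\in\mathrm{Plays}(\sigma,v)$. -/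

import Mathlib

/-- The two players: `even` is the player written as a diamond, `odd` the one written as a box. -/
inductive Player : Type
  | even
  | odd

/-- A parity game on the set of vertices `V`. The map `owner` encodes the partition of the
vertices between the players. Finiteness of `V` is required where the games are used. -/
structure ParityGame (V : Type*) where
  Edge : V → V → Prop
  total : ∀ v, ∃ w, Edge v w
  priority : V → ℕ
  owner : V → Player

/-- `d`-tuples of natural numbers, indexed by `0, …, d - 1` and ordered lexicographically (the
component `0` being the most significant one), together with a greatest element `⊤`. -/
abbrev MTuple (d : ℕ) : Type := WithTop (Lex (Fin d → ℕ))

namespace MTuple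

/-- `(α₀, …, αᵢ, 0, …, 0)`, and `⊤` for `⊤`. -/
def truncate {d : ℕ} (i : ℕ) : MTuple d → MTuple d :=
  WithTop.map fun α => toLex fun j : Fin d => if (j : ℕ) ≤ i then ofLex α j else 0

/-- The derived order `α <ᵢ β`: `(α₀, …, αᵢ)` is lexicographically smaller than `(β₀, …, βᵢ)`;
a tuple is always smaller than `⊤`. -/
def LTUpTo {d : ℕ} (i : ℕ) (α β : MTuple d) : Prop := truncate i α < truncate i β

/-- The derived order `α ≤ᵢ β`. -/
def LEUpTo {d : ℕ} (i : ℕ) (α β : MTuple d) : Prop := truncate i α ≤ truncate i β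

theorem truncate_mono {d : ℕ} (i : ℕ) : Monotone (truncate (d := d) i) := by
  refine WithTop.monotone_map_iff.2 (fun α β h => ?_)
  rcases h.lt_or_eq with h | h
  · obtain ⟨j, hj, hlt⟩ := h
    by_cases hji : (j : ℕ) ≤ i
    · refine le_of_lt ⟨j, fun l hl => ?_, ?_⟩
      · have := hj l hl
        have hli : (l : ℕ) ≤ i := le_trans (le_of_lt hl) hji
        show (if (l : ℕ) ≤ i then _ else 0) = (if (l : ℕ) ≤ i then _ else 0)
        rw [if_pos hli, if_pos hli]; exact this
      · show (if (j : ℕ) ≤ i then _ else 0) < (if (j : ℕ) ≤ i then _ else 0)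
        rw [if_pos hji, if_pos hji]; exact hlt
    · refine le_of_eq (congrArg toLex (funext fun l => ?_))
      by_cases hli : (l : ℕ) ≤ i
      · rw [if_pos hli, if_pos hli]
        exact hj l (by show (l:ℕ) < j; omega)
      · rw [if_neg hli, if_neg hli]
  · rw [h]

end MTuple

namespace ParityGame

/-! ### Plays and strategies -/

section Plays

variable {V : Type*} (G : ParityGame V)

/-- An infinite path. -/
def IsPlay (π : ℕ → V) : Prop := ∀ n, G.Edge (π n) (π (n + 1))

/-- The least priority that occurs infinitely often on a play. -/
noncomputable def minInfPriority (π : ℕ → V) : ℕ :=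
  sInf {k | ∃ᶠ n in Filter.atTop, G.priority (π n) = k}

/-- Player `even` wins a play iff the least priority that occurs infinitely often on it is even. -/
def EvenWins (π : ℕ → V) : Prop := Even (G.minInfPriority π)

/-- A strategy of the player `p`: a partial function from non-empty histories to vertices, which,
where it is defined on a finite path, has the path end in a vertex of `p` and moves to one of its
successors. (The value at the empty list plays no role.) -/
structure Strategy (p : Player) where
  move : List V → Option V
  legal : ∀ (l : List V) (u w : V), (l ++ [u]).IsChain G.Edge → move (l ++ [u]) = some w →
    G.owner u = p ∧ G.Edge u w

/-- A positional strategy of the player `p`: a choice of a successor for every vertex of `p`. -/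
structure PositionalStrategy (p : Player) where
  move : {u : V // G.owner u = p} → V
  legal : ∀ u, G.Edge u.1 (move u)

open Classical in
/-- A positional strategy, seen as a strategy: it is defined on the histories that end in a vertex
of `p`, and looks only at that last vertex. -/
noncomputable def PositionalStrategy.toStrategy {G : ParityGame V} {p : Player}
    (σ : G.PositionalStrategy p) : G.Strategy p where
  move l := l.getLast?.bind fun u => if h : G.owner u = p then some (σ.move ⟨u, h⟩) else none
  legal := by
    intro l u w _ h
    by_cases hu : G.owner u = p
    · simp [hu] at h
      exact ⟨hu, h ▸ σ.legal ⟨u, hu⟩⟩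
    · simp [hu] at h

/-- The play `π` is consistent with `σ`: it follows `σ` after every prefix `π 0, …, π n` on which
`σ` is defined. -/
def Consistent {p : Player} (σ : G.Strategy p) (π : ℕ → V) : Prop :=
  ∀ (n : ℕ) (w : V), σ.move ((List.range (n + 1)).map π) = some w → π (n + 1) = w

/-- The plays that start in `v` and are consistent with `σ`. -/
def plays {p : Player} (σ : G.Strategy p) (v : V) : Set (ℕ → V) :=
  {π | G.IsPlay π ∧ π 0 = v ∧ G.Consistent σ π}

/-- The stretch `π s, …, π (s + l)` is `k`-dominated: `k` is the least priority in it. -/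
def IsDominatedStretch (π : ℕ → V) (k s l : ℕ) : Prop :=
  IsLeast ((fun j => G.priority (π j)) '' Set.Icc s (s + l)) k

/-- The number of occurrences of vertices of priority `k` in the stretch `π s, …, π (s + l)`. -/
def stretchDegree (π : ℕ → V) (k s l : ℕ) : ℕ :=
  ((Finset.Icc s (s + l)).filter fun j => G.priority (π j) = k).card

/-- The degrees of the `k`-dominated stretches that are prefixes of `π`. -/
def prefixDegrees (π : ℕ → V) (k : ℕ) : Set ℕ :=
  {m | ∃ l, G.IsDominatedStretch π k 0 l ∧ m = G.stretchDegree π k 0 l}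

/-- The degree of the maximal `k`-dominated stretch that is a prefix of `π`. Degrees increase with
the prefix, so this is the greatest degree of a `k`-dominated finite prefix, also where the maximal
stretch is infinite; it is `0` if there is no such prefix. -/
noncomputable def maxPrefixDegree (π : ℕ → V) (k : ℕ) : ℕ := sSup (G.prefixDegrees π k)

/-- The supremum in `maxPrefixDegree` is that of a bounded set in the case of interest. -/
theorem bddAbove_prefixDegrees {π : ℕ → V} (hπ : G.EvenWins π) {k : ℕ} (hk : Odd k) :
    BddAbove (G.prefixDegrees π k) := by
  by_contra hb
  rw [not_bddAbove_iff] at hb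
  have hfar : ∀ N, ∃ j, N ≤ j ∧ G.priority (π j) = k ∧ ∀ i ≤ j, k ≤ G.priority (π i) := by
    intro N
    obtain ⟨m, ⟨l, hl, rfl⟩, hm⟩ := hb N
    obtain ⟨j, hj, hjN⟩ : ∃ j ∈ (Finset.Icc 0 (0 + l)).filter (fun j => G.priority (π j) = k),
        N ≤ j := by
      by_contra hcon
      push Not at hcon
      have hsub : (Finset.Icc 0 (0 + l)).filter (fun j => G.priority (π j) = k)
          ⊆ Finset.range N := fun j hj => Finset.mem_range.2 (hcon j hj)
      have := Finset.card_le_card hsub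
      rw [Finset.card_range] at this
      exact absurd hm (not_lt.2 this)
    rw [Finset.mem_filter, Finset.mem_Icc] at hj
    exact ⟨j, hjN, hj.2, fun i hi => hl.2 ⟨i, ⟨i.zero_le, hi.trans hj.1.2⟩, rfl⟩⟩
  have hmem : k ∈ {k | ∃ᶠ n in Filter.atTop, G.priority (π n) = k} := by
    refine Filter.frequently_atTop.2 fun N => ?_
    obtain ⟨j, hj, hjk, -⟩ := hfar N
    exact ⟨j, hj, hjk⟩
  have hmin : G.minInfPriority π = k := by
    refine le_antisymm (Nat.sInf_le hmem) ?_
    refine le_csInf ⟨k, hmem⟩ fun b hb => ?_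
    obtain ⟨i, hi⟩ := Filter.Frequently.exists hb
    obtain ⟨j, hj, -, hall⟩ := hfar i
    exact hi ▸ hall i hj
  rw [EvenWins, hmin] at hπ
  exact (Nat.not_even_iff_odd.2 hk) hπ

end Plays

/-! ### Progress measures and play values -/

section Measures

variable {V : Type*} [Fintype V] (G : ParityGame V)

/-- One more than the largest priority in the game. -/
def dim : ℕ := Finset.univ.sup G.priority + 1

/-- The number of vertices of priority `i`. -/
def numPriority (i : ℕ) : ℕ := (Finset.univ.filter fun v => G.priority v = i).card

/-- `⊤`, and the tuples that are `0` at even positions (and arbitrary at odd ones). -/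
def extMeasures : Set (MTuple G.dim) :=
  {m | ∀ α : Lex (Fin G.dim → ℕ), m = ↑α → ∀ i : Fin G.dim, Even (i : ℕ) → ofLex α i = 0}

/-- `⊤`, and the tuples that are `0` at even positions and at most the number of vertices of
priority `i` at odd positions `i`. -/
def measures : Set (MTuple G.dim) :=
  {m | ∀ α : Lex (Fin G.dim → ℕ), m = ↑α → ∀ i : Fin G.dim,
    (Even (i : ℕ) → ofLex α i = 0) ∧ (Odd (i : ℕ) → ofLex α i ≤ G.numPriority i)}

/-- The candidates among which `prog ρ v w` is the least. -/
def progSet (ρ : V → MTuple G.dim) (v w : V) : Set (MTuple G.dim) :=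
  {m ∈ G.measures |
    (Even (G.priority v) → MTuple.LEUpTo (G.priority v) (ρ w) m) ∧
    (Odd (G.priority v) → MTuple.LTUpTo (G.priority v) (ρ w) m ∨ (m = ρ w ∧ ρ w = ⊤))}

theorem top_mem_progSet (ρ : V → MTuple G.dim) (v w : V) : ⊤ ∈ G.progSet ρ v w := by
  refine ⟨fun α h => absurd h (WithTop.top_ne_coe), fun _ => le_top, fun _ => ?_⟩
  cases h : ρ w with
  | none => exact Or.inr ⟨rfl, rfl⟩
  | some α => exact Or.inl (WithTop.coe_lt_top _)

/-- The least measure that satisfies the progress condition of the edge from `v` to `w`. -/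
noncomputable def prog (ρ : V → MTuple G.dim) (v w : V) : MTuple G.dim :=
  (wellFounded_lt (α := MTuple G.dim)).min (G.progSet ρ v w) ⟨⊤, G.top_mem_progSet ρ v w⟩

theorem isLeast_prog (ρ : V → MTuple G.dim) (v w : V) :
    IsLeast (G.progSet ρ v w) (G.prog ρ v w) :=
  ⟨WellFounded.min_mem _ _ _, fun _ hm => not_lt.1 (WellFounded.not_lt_min _ _ hm)⟩

/-- Game parity progress measures. -/
def IsProgressMeasure (ρ : V → MTuple G.dim) : Prop :=
  (∀ v, ρ v ∈ G.measures) ∧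
  ∀ v,
    (G.owner v = Player.even →
      ∃ w, G.Edge v w ∧ MTuple.LEUpTo (G.priority v) (G.prog ρ v w) (ρ v)) ∧
    (G.owner v = Player.odd →
      ∀ w, G.Edge v w → MTuple.LEUpTo (G.priority v) (G.prog ρ v w) (ρ v))

theorem progSet_anti {ρ ρ' : V → MTuple G.dim} (h : ρ ≤ ρ') (v w : V) :
    G.progSet ρ' v w ⊆ G.progSet ρ v w := by
  intro m hm
  refine ⟨hm.1, fun e => (MTuple.truncate_mono _ (h w)).trans (hm.2.1 e), fun o => ?_⟩
  rcases hm.2.2 o with h1 | ⟨h1, h2⟩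
  · exact Or.inl ((MTuple.truncate_mono _ (h w)).trans_lt h1)
  · have hmt : m = ⊤ := h1.trans h2
    subst hmt
    cases hw : ρ w with
    | none => exact Or.inr ⟨rfl, rfl⟩
    | some α => exact Or.inl (WithTop.coe_lt_top _)

/-- The least game parity progress measure exists. -/
theorem exists_isLeast_progressMeasure :
    ∃ ρ : V → MTuple G.dim, IsLeast {ρ' : V → MTuple G.dim | G.IsProgressMeasure ρ'} ρ := by
  have htop : G.IsProgressMeasure fun _ => ⊤ := by
    refine ⟨fun v α h => absurd h WithTop.top_ne_coe, fun v => ⟨fun _ => ?_, fun _ w hw => le_top⟩⟩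
    obtain ⟨w, hw⟩ := G.total v
    exact ⟨w, hw, le_top⟩
  have key : ∀ v, ∃ m,
      IsLeast ((fun ρ : V → MTuple G.dim => ρ v) '' {ρ | G.IsProgressMeasure ρ}) m :=
    fun v => ⟨wellFounded_lt.min ((fun ρ : V → MTuple G.dim => ρ v) '' {ρ | G.IsProgressMeasure ρ}) ⟨_, _, htop, rfl⟩, WellFounded.min_mem _ _ _,
      fun _ hm => not_lt.1 (WellFounded.not_lt_min wellFounded_lt _ hm)⟩
  choose r hr using key
  have hle : ∀ ρ, G.IsProgressMeasure ρ → r ≤ ρ := fun ρ h v => (hr v).2 ⟨ρ, h, rfl⟩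
  have hprog : ∀ ρ, G.IsProgressMeasure ρ → ∀ v w, G.prog r v w ≤ G.prog ρ v w := fun ρ h v w =>
    (G.isLeast_prog r v w).2 (G.progSet_anti (hle ρ h) v w (G.isLeast_prog ρ v w).1)
  refine ⟨r, ⟨fun v => ?_, fun v => ?_⟩, hle⟩
  · obtain ⟨ρ, h, e⟩ := (hr v).1
    exact e ▸ h.1 v
  · obtain ⟨ρ, h, e⟩ := (hr v).1
    refine ⟨fun o => ?_, fun o w hw => ?_⟩
    · obtain ⟨w, hw, hh⟩ := (h.2 v).1 o
      exact ⟨w, hw, (MTuple.truncate_mono _ (hprog ρ h v w)).trans (e ▸ hh)⟩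
    · exact (MTuple.truncate_mono _ (hprog ρ h v w)).trans (e ▸ (h.2 v).2 o w hw)

open Classical in
/-- The value of a play for player `even`: `⊤` if player `odd` wins the play, and else the tuple
of the degrees of the maximal `i`-dominated prefixes of the play, for the odd `i`. -/
noncomputable def value (π : ℕ → V) : MTuple G.dim :=
  if G.EvenWins π then
    ↑(toLex fun i : Fin G.dim => if Odd (i : ℕ) then G.maxPrefixDegree π i else 0)
  else ⊤

end Measures

end ParityGame

/-! Both the value of a play and the progress condition are governed by one monotone operation,
`backup p`: it erases the components above `p` and adds one to component `p` if `p` is odd. The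
value of a play is the backup of the value of its tail (`value_eq_backup`), and `ρ` is a progress
measure iff `backup (priority v) (ρ w) ≤ ρ v` holds for some, respectively all, successors `w` of
`v` (`isProgressMeasure_iff`).

Upper bound: let player even always move to a successor witnessing this inequality. Along the
resulting play the inequality holds at every step. If the initial measure is finite, an odd least
recurring priority would yield an infinite descent, so even wins; some tail of the play then has
value zero, and the inequality carries the bound back to the start (`value_le_of_backup_le`).

Lower bound: let `ν v` be the greatest element of `measures` that player odd can force from `v`.
Prepending a move to strategies shows that `ν` is a progress measure, hence above the least one,
provided that forcing an arbitrary tuple entails forcing an element of `measures` above it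
(`OddForces.exists_measure`). For this, odd deletes from the history every loop dominated by an odd
priority and plays on the reduced history. If the reduced histories grow forever, they converge to a
play of the original strategy which repeats no vertex in an odd-dominated way, so that its value is
in `measures` by pigeonhole, and which is worth no more than the actual play. Otherwise odd wins the
actual play. -/

namespace MTuple

/-! ### Order properties of truncation and backup -/

variable {d : ℕ}

/-- The value of a play as a function of the value of the play without its first vertex, which has
priority `p`. -/
def backup (p : ℕ) : MTuple d → MTuple d :=
  WithTop.map fun α => toLex fun j : Fin d =>
    if (j : ℕ) < p then ofLex α j
    else if (j : ℕ) = p then ofLex α j + (if Odd p then 1 else 0) else 0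

theorem backup_coe (p : ℕ) (α : Lex (Fin d → ℕ)) :
    backup p (α : MTuple d) = ((toLex fun j : Fin d =>
      if (j : ℕ) < p then ofLex α j
      else if (j : ℕ) = p then ofLex α j + (if Odd p then 1 else 0) else 0 :
        Lex (Fin d → ℕ)) : MTuple d) := rfl

theorem truncate_coe (p : ℕ) (α : Lex (Fin d → ℕ)) :
    truncate p (α : MTuple d) =
      ((toLex fun j : Fin d => if (j : ℕ) ≤ p then ofLex α j else 0 : Lex (Fin d → ℕ)) :
        MTuple d) := rfl

theorem coe_toLex_mono {f g : Fin d → ℕ} (h : f ≤ g) :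
    ((toLex f : Lex (Fin d → ℕ)) : MTuple d) ≤ (toLex g : Lex (Fin d → ℕ)) :=
  WithTop.coe_le_coe.2 (Pi.toLex_monotone h)

@[simp] theorem backup_top (p : ℕ) : backup p (⊤ : MTuple d) = ⊤ := rfl

@[simp] theorem truncate_top (p : ℕ) : truncate p (⊤ : MTuple d) = ⊤ := rfl

theorem truncate_le_self (p : ℕ) (x : MTuple d) : truncate p x ≤ x := by
  induction x using WithTop.recTopCoe with
  | top => exact le_top
  | coe α =>
    refine coe_toLex_mono (g := ofLex α) fun j => ?_
    dsimp only
    split_ifs <;> simp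

theorem truncate_truncate {p q : ℕ} (h : p ≤ q) (x : MTuple d) :
    truncate p (truncate q x) = truncate p x := by
  induction x using WithTop.recTopCoe with
  | top => rfl
  | coe α =>
    simp only [truncate_coe, ofLex_toLex]
    congr 2
    funext j
    split_ifs <;> first | rfl | omega

theorem truncate_backup (p : ℕ) (x : MTuple d) : truncate p (backup p x) = backup p x := by
  induction x using WithTop.recTopCoe with
  | top => rfl
  | coe α =>
    simp only [truncate_coe, backup_coe, ofLex_toLex]
    congr 2
    funext j
    split_ifs <;> first | rfl | omega

theorem truncate_le_backup (p : ℕ) (x : MTuple d) : truncate p x ≤ backup p x := by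
  induction x using WithTop.recTopCoe with
  | top => exact le_top
  | coe α =>
    refine coe_toLex_mono fun j => ?_
    dsimp only
    split_ifs <;> omega

theorem backup_of_even {p : ℕ} (hp : Even p) (x : MTuple d) : backup p x = truncate p x := by
  induction x using WithTop.recTopCoe with
  | top => rfl
  | coe α =>
    simp only [truncate_coe, backup_coe, if_neg (Nat.not_odd_iff_even.2 hp)]
    congr 2
    funext j
    split_ifs <;> first | rfl | omega

theorem truncate_lt_backup {p : ℕ} (hp : Odd p) (hd : p < d) {x : MTuple d} (hx : x ≠ ⊤) :
    truncate p x < backup p x := by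
  lift x to Lex (Fin d → ℕ) using hx
  refine WithTop.coe_lt_coe.2 ⟨⟨p, hd⟩, fun j hj => ?_, ?_⟩
  · have hj' : (j : ℕ) < p := hj
    simp [hj', hj'.le]
  · simp [hp]

theorem truncate_le_iff (p : ℕ) (x y : MTuple d) :
    truncate p x ≤ truncate p y ↔ truncate p x ≤ y :=
  ⟨fun h => h.trans (truncate_le_self p y), fun h => by
    simpa only [truncate_truncate le_rfl] using truncate_mono p h⟩

/-- A backup vanishes above `p`, so the components of `y` above `p` cannot affect the comparison. -/
theorem backup_le_iff (p : ℕ) (x y : MTuple d) :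
    backup p x ≤ truncate p y ↔ backup p x ≤ y := by
  rw [← truncate_backup, truncate_le_iff]

/-- For odd `p` the backup is the immediate successor of `truncate p x` among the tuples supported
on `0, …, p`. Otherwise `truncate p y` would lie strictly between the two; the position `i` where it
first differs from the backup rules this out. -/
theorem backup_le_of_truncate_lt {p : ℕ} (hp : Odd p) {x y : MTuple d}
    (h : truncate p x < truncate p y) : backup p x ≤ y := by
  rw [← backup_le_iff]
  by_contra hc
  rw [not_le] at hc
  induction x using WithTop.recTopCoe with
  | top => exact not_top_lt h
  | coe α =>
    induction y using WithTop.recTopCoe with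
    | top => exact not_top_lt hc
    | coe β =>
      obtain ⟨i, hi, hlt⟩ := WithTop.coe_lt_coe.1 hc
      refine absurd h (not_lt.2 (WithTop.coe_le_coe.2 ?_))
      -- Above `p` both compared tuples are zero, so `i ≤ p`; strictly below `p` the backup leaves
      -- the components of `x` unchanged.
      have heq : ∀ j : Fin d, (j : ℕ) < i → (j : ℕ) ≤ p → β j = α j := by
        intro j hj hjp
        have := hi j hj
        simp only [Pi.ofLex_apply, Pi.toLex_apply, if_pos hjp] at this
        have h2 : (i : ℕ) ≤ p := by
          by_contra h3
          simp [not_lt.2 (le_of_not_ge h3), (lt_of_not_ge h3).ne'] at hlt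
        rwa [if_pos (lt_of_lt_of_le hj h2)] at this
      rcases lt_trichotomy (i : ℕ) p with hip | hip | hip
      · refine le_of_lt ⟨i, fun j hj => ?_, ?_⟩
        · have hj' : (j : ℕ) ≤ p := le_trans (le_of_lt hj) hip.le
          simpa [hj'] using heq j hj hj'
        · simpa [hip, hip.le] using hlt
      -- At `i = p` the strict inequality is against `α i + 1`.
      · have hle : β i ≤ α i := by
          simp [hip, hp] at hlt
          omega
        refine Pi.toLex_monotone fun j => ?_
        rcases lt_trichotomy (j : ℕ) i with hj | hj | hj
        · have hj' : (j : ℕ) ≤ p := by omega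
          simpa [hj'] using (heq j hj hj').le
        · obtain rfl := Fin.ext hj
          simpa [hip] using hle
        · have hj' : ¬ (j : ℕ) ≤ p := by omega
          simp [hj']
      · simp [not_lt.2 hip.le, hip.ne'] at hlt

/-- A first difference at a position at most `p` survives; a later one is erased, and the two
backups coincide. -/
theorem backup_mono (p : ℕ) : Monotone (backup (d := d) p) := by
  intro x y h
  induction y using WithTop.recTopCoe with
  | top => exact le_top
  | coe β =>
    lift x to Lex (Fin d → ℕ) using ne_top_of_le_ne_top WithTop.coe_ne_top h
    rcases (WithTop.coe_le_coe.1 h).lt_or_eq with h | rfl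
    · obtain ⟨i, hi, hlt⟩ := h
      refine WithTop.coe_le_coe.2 ?_
      by_cases hip : (i : ℕ) ≤ p
      · refine le_of_lt ⟨i, fun j hj => ?_, ?_⟩
        · have : (j : ℕ) < p := lt_of_lt_of_le hj hip
          simpa [this] using hi j hj
        · rcases hip.lt_or_eq with hip | hip
          · simpa [hip] using hlt
          · simpa [hip] using hlt
      · refine Pi.toLex_monotone fun j => ?_
        by_cases hj : (j : ℕ) ≤ p
        · have := hi j (by show (j : ℕ) < i; omega)
          rw [Pi.ofLex_apply, Pi.ofLex_apply, this]
        · rw [if_neg (by omega), if_neg (by omega)]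
          exact Nat.zero_le _
    · exact le_rfl

end MTuple

namespace ParityGame

open MTuple

/-! ### The progress condition in terms of backup -/

section Measures

variable {V : Type*} [Fintype V] (G : ParityGame V)

theorem priority_lt_dim (v : V) : G.priority v < G.dim :=
  Nat.lt_succ_of_le (Finset.le_sup (Finset.mem_univ v))

/-- One inequality covers both parities and `⊤`: for even priorities the backup is the truncation,
for odd ones its successor, and `⊤` is fixed. -/
theorem mem_progSet {ρ : V → MTuple G.dim} {v w : V} {m : MTuple G.dim} :
    m ∈ G.progSet ρ v w ↔ m ∈ G.measures ∧ backup (G.priority v) (ρ w) ≤ m := by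
  refine and_congr_right fun _ => ?_
  rcases Nat.even_or_odd (G.priority v) with he | ho
  · simp only [he, Nat.not_odd_iff_even.2 he, true_imp_iff, false_imp_iff, and_true, LEUpTo]
    rw [backup_of_even he, truncate_le_iff]
  · simp only [ho, Nat.not_even_iff_odd.2 ho, true_imp_iff, false_imp_iff, true_and, LTUpTo]
    constructor
    · rintro (h | ⟨rfl, h⟩)
      · exact backup_le_of_truncate_lt ho h
      · rw [h]; exact le_top
    · intro h
      by_cases hw : ρ w = ⊤
      · right
        rw [hw, backup_top, top_le_iff] at h
        exact ⟨h.trans hw.symm, hw⟩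
      · left
        exact (truncate_lt_backup ho (G.priority_lt_dim v) hw).trans_le ((backup_le_iff _ _ _).2 h)

theorem prog_leUpTo_iff {ρ : V → MTuple G.dim} {v w : V} {m : MTuple G.dim}
    (hm : m ∈ G.measures) :
    LEUpTo (G.priority v) (G.prog ρ v w) m ↔ backup (G.priority v) (ρ w) ≤ m := by
  constructor
  · intro h
    have h1 := (G.mem_progSet.1 (G.isLeast_prog ρ v w).1).2
    exact ((backup_le_iff _ _ _).2 h1).trans (h.trans (truncate_le_self _ _))
  · intro h
    exact truncate_mono _ ((G.isLeast_prog ρ v w).2 (G.mem_progSet.2 ⟨hm, h⟩))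

theorem isProgressMeasure_iff {ρ : V → MTuple G.dim} :
    G.IsProgressMeasure ρ ↔ (∀ v, ρ v ∈ G.measures) ∧ ∀ v,
      (G.owner v = Player.even → ∃ w, G.Edge v w ∧ backup (G.priority v) (ρ w) ≤ ρ v) ∧
      (G.owner v = Player.odd → ∀ w, G.Edge v w → backup (G.priority v) (ρ w) ≤ ρ v) := by
  refine and_congr_right fun h => forall_congr' fun v => ?_
  simp only [G.prog_leUpTo_iff (h v)]

theorem measures_subset_extMeasures : G.measures ⊆ G.extMeasures :=
  fun _ hm α hα i => (hm α hα i).1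

theorem top_mem_measures : ⊤ ∈ G.measures := fun _ h => absurd h WithTop.top_ne_coe

theorem finite_measures : G.measures.Finite := by
  have hf : (Set.Iic fun i : Fin G.dim => G.numPriority i).Finite := Set.finite_Iic _
  refine ((hf.image fun f => ((toLex f : Lex (Fin G.dim → ℕ)) : MTuple G.dim)).insert ⊤).subset ?_
  intro m hm
  induction m using WithTop.recTopCoe with
  | top => exact Or.inl rfl
  | coe α =>
    refine Or.inr ⟨ofLex α, fun i => ?_, rfl⟩
    rcases Nat.even_or_odd (i : ℕ) with he | ho
    · exact ((hm α rfl i).1 he).trans_le (Nat.zero_le _)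
    · exact (hm α rfl i).2 ho

end Measures

/-! ### Degrees of dominated prefixes as numbers of times -/

section Plays

variable {V : Type*} (G : ParityGame V)

/-- The times at which a vertex of priority `k` occurs in the maximal `k`-dominated prefix. -/
def dominatedTimes (π : ℕ → V) (k : ℕ) : Set ℕ :=
  {n | G.priority (π n) = k ∧ ∀ m ≤ n, k ≤ G.priority (π m)}

theorem maxPrefixDegree_eq {π : ℕ → V} {k : ℕ} (hf : (G.dominatedTimes π k).Finite) :
    G.maxPrefixDegree π k = (G.dominatedTimes π k).ncard := by
  have hle : ∀ m ∈ G.prefixDegrees π k, m ≤ (G.dominatedTimes π k).ncard := by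
    rintro m ⟨l, hl, rfl⟩
    rw [stretchDegree, ← Set.ncard_coe_finset]
    refine Set.ncard_le_ncard (fun n hn => ?_) hf
    rw [Finset.mem_coe, Finset.mem_filter, Finset.mem_Icc] at hn
    exact ⟨hn.2, fun m hm => hl.2 ⟨m, ⟨m.zero_le, hm.trans hn.1.2⟩, rfl⟩⟩
  rcases (G.dominatedTimes π k).eq_empty_or_nonempty with he | hne
  · rw [he, Set.ncard_empty] at hle ⊢
    exact Nat.le_zero.1 (csSup_le' fun m hm => hle m hm)
  · obtain ⟨l, hl, hmax⟩ := Set.exists_max_image _ id hf hne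
    refine (IsGreatest.csSup_eq ⟨⟨l, ⟨⟨l, ⟨l.zero_le, by simp⟩, hl.1⟩, ?_⟩, ?_⟩, hle⟩)
    · rintro _ ⟨j, hj, rfl⟩
      exact hl.2 j (by simpa using hj.2)
    · rw [stretchDegree, ← Set.ncard_coe_finset]
      congr 1
      ext n
      simp only [Finset.coe_filter, Finset.mem_Icc, zero_add, Nat.zero_le, true_and,
        Set.mem_ofPred_eq]
      constructor
      · intro hn
        exact ⟨hmax n hn, hn.1⟩
      · rintro ⟨hn, hk⟩
        exact ⟨hk, fun m hm => hl.2 m (hm.trans hn)⟩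

theorem minInfPriority_eq {π : ℕ → V} {k : ℕ} (hk : ∃ᶠ n in Filter.atTop, G.priority (π n) = k)
    (hle : ∀ᶠ n in Filter.atTop, k ≤ G.priority (π n)) : G.minInfPriority π = k := by
  refine IsLeast.csInf_eq ⟨hk, fun j hj => ?_⟩
  obtain ⟨n, hn, hn'⟩ := (Filter.Frequently.and_eventually hj hle).exists
  exact hn ▸ hn'

theorem finite_dominatedTimes {π : ℕ → V} (hπ : G.EvenWins π) {k : ℕ} (hk : Odd k) :
    (G.dominatedTimes π k).Finite := by
  by_contra hinf
  have hfr := Nat.frequently_atTop_iff_infinite.2 hinf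
  have : G.minInfPriority π = k := by
    refine G.minInfPriority_eq (hfr.mono fun n hn => hn.1) (.of_forall fun n => ?_)
    obtain ⟨m, hm, hmd⟩ := Filter.frequently_atTop.1 hfr n
    exact hmd.2 n hm
  rw [EvenWins, this] at hπ
  exact Nat.not_even_iff_odd.2 hk hπ

theorem minInfPriority_shift (π : ℕ → V) :
    G.minInfPriority (fun n => π (n + 1)) = G.minInfPriority π := by
  unfold minInfPriority
  congr 1
  ext k
  simp only [Set.mem_ofPred_eq, Filter.frequently_atTop]
  constructor
  · intro h a
    obtain ⟨b, hb, hk⟩ := h a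
    exact ⟨b + 1, by omega, hk⟩
  · intro h a
    obtain ⟨b, hb, hk⟩ := h (a + 1)
    exact ⟨b - 1, by omega, by rwa [Nat.sub_add_cancel (by omega)]⟩

theorem evenWins_shift (π : ℕ → V) : G.EvenWins (fun n => π (n + 1)) ↔ G.EvenWins π := by
  rw [EvenWins, EvenWins, minInfPriority_shift]

theorem succ_mem_dominatedTimes {π : ℕ → V} {k n : ℕ} :
    n + 1 ∈ G.dominatedTimes π k ↔
      k ≤ G.priority (π 0) ∧ n ∈ G.dominatedTimes (fun n => π (n + 1)) k := by
  constructor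
  · rintro ⟨h1, h2⟩
    exact ⟨h2 0 (by omega), h1, fun m hm => h2 (m + 1) (by omega)⟩
  · rintro ⟨h0, h1, h2⟩
    refine ⟨h1, fun m hm => ?_⟩
    rcases m with _ | m
    · exact h0
    · exact h2 m (by omega)

theorem zero_mem_dominatedTimes {π : ℕ → V} {k : ℕ} :
    0 ∈ G.dominatedTimes π k ↔ G.priority (π 0) = k :=
  ⟨fun h => h.1, fun h => ⟨h, fun m hm => by rw [Nat.le_zero.1 hm, h]⟩⟩

theorem ncard_dominatedTimes_of_lt {π : ℕ → V} {k : ℕ} (h : k < G.priority (π 0)) :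
    (G.dominatedTimes π k).ncard = (G.dominatedTimes (fun n => π (n + 1)) k).ncard := by
  rw [← Set.ncard_image_of_injective (G.dominatedTimes (fun n => π (n + 1)) k) Nat.succ_injective]
  congr 1
  ext n
  rcases n with _ | n
  · simp [zero_mem_dominatedTimes, h.ne']
  · simp [succ_mem_dominatedTimes, h.le]

theorem ncard_dominatedTimes_of_eq {π : ℕ → V} {k : ℕ} (h : k = G.priority (π 0))
    (hf : (G.dominatedTimes (fun n => π (n + 1)) k).Finite) :
    (G.dominatedTimes π k).ncard = (G.dominatedTimes (fun n => π (n + 1)) k).ncard + 1 := by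
  rw [← Set.ncard_image_of_injective (G.dominatedTimes (fun n => π (n + 1)) k) Nat.succ_injective,
    ← Set.ncard_insert_of_notMem (a := 0) (by simp) (hf.image _)]
  congr 1
  ext n
  rcases n with _ | n
  · simp [zero_mem_dominatedTimes, h]
  · simp [succ_mem_dominatedTimes, h.le]

theorem dominatedTimes_of_gt {π : ℕ → V} {k : ℕ} (h : G.priority (π 0) < k) :
    G.dominatedTimes π k = ∅ :=
  Set.eq_empty_of_forall_notMem fun n hn => absurd (hn.2 0 n.zero_le) (not_le.2 h)

end Plays

/-! ### Values of plays and the descent along a progress measure -/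

section Values

variable {V : Type*} [Fintype V] (G : ParityGame V)

open Classical in
theorem value_of_evenWins {π : ℕ → V} (h : G.EvenWins π) :
    G.value π = ((toLex fun i : Fin G.dim =>
      if Odd (i : ℕ) then (G.dominatedTimes π i).ncard else 0 : Lex (Fin G.dim → ℕ)) :
        MTuple G.dim) := by
  rw [value, if_pos h]
  congr 2
  funext i
  split_ifs with hi
  · exact G.maxPrefixDegree_eq (G.finite_dominatedTimes h hi)
  · rfl

theorem value_of_not_evenWins {π : ℕ → V} (h : ¬ G.EvenWins π) : G.value π = ⊤ := by
  rw [value, if_neg h]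

/-- A first vertex of priority `p` leaves the degrees below `p` unchanged, counts once for `p`
itself, and prevents domination by any larger priority. The winner does not depend on it. -/
theorem value_eq_backup (π : ℕ → V) :
    G.value π = backup (G.priority (π 0)) (G.value fun n => π (n + 1)) := by
  by_cases h : G.EvenWins π
  · have h' := (G.evenWins_shift π).2 h
    rw [G.value_of_evenWins h, G.value_of_evenWins h', backup_coe]
    congr 2
    funext i
    simp only [ofLex_toLex]
    rcases lt_trichotomy (i : ℕ) (G.priority (π 0)) with hi | hi | hi
    · rw [if_pos hi, G.ncard_dominatedTimes_of_lt hi]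
    · rw [if_neg hi.not_lt, if_pos hi, ← hi]
      split_ifs with ho
      · exact G.ncard_dominatedTimes_of_eq hi (G.finite_dominatedTimes h' ho)
      · rfl
    · rw [if_neg hi.not_gt, if_neg hi.ne', G.dominatedTimes_of_gt hi]
      simp
  · rw [G.value_of_not_evenWins h, G.value_of_not_evenWins (mt (G.evenWins_shift π).1 h),
      backup_top]

/-- The least priority that occurs infinitely often does occur infinitely often, and eventually no
lesser priority occurs. -/
theorem minInfPriority_spec (π : ℕ → V) :
    (∃ᶠ n in Filter.atTop, G.priority (π n) = G.minInfPriority π) ∧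
      ∀ᶠ n in Filter.atTop, G.minInfPriority π ≤ G.priority (π n) := by
  constructor
  · have hne : {k | ∃ᶠ n in Filter.atTop, G.priority (π n) = k}.Nonempty := by
      by_contra hne
      rw [Set.not_nonempty_iff_eq_empty, Set.eq_empty_iff_forall_notMem] at hne
      -- If no priority recurred, each of the finitely many would eventually be absent, and so all
      -- of them at once.
      have := (Filter.eventually_all_finite (Set.finite_Iio G.dim)
        (l := Filter.atTop) (p := fun k n => ¬ G.priority (π n) = k)).2
          fun k _ => Filter.not_frequently.1 (hne k)
      obtain ⟨n, hn⟩ := this.exists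
      exact hn _ (G.priority_lt_dim _) rfl
    exact Nat.sInf_mem hne
  · have := (Filter.eventually_all_finite (Set.finite_Iio (G.minInfPriority π))
      (l := Filter.atTop) (p := fun k n => ¬ G.priority (π n) = k)).2
        fun k hk => Filter.not_frequently.1 fun h => Nat.notMem_of_lt_sInf hk h
    exact this.mono fun n hn => not_lt.1 fun h => hn _ h rfl

/-- Start the tail at a late visit to the least recurring priority, which is even. No smaller
priority occurs any more and the first vertex excludes larger ones, so no odd priority dominates a
prefix and the value is zero. -/
theorem exists_value_shift_le {π : ℕ → V} (h : G.EvenWins π) :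
    ∃ N, ∀ x : MTuple G.dim, G.value (fun n => π (N + n)) ≤ x := by
  obtain ⟨h1, h2⟩ := G.minInfPriority_spec π
  obtain ⟨M, hM⟩ := Filter.eventually_atTop.1 h2
  obtain ⟨N, hN, hNk⟩ := Filter.frequently_atTop.1 h1 M
  have hk : G.minInfPriority (fun n => π (N + n)) = G.minInfPriority π := by
    refine G.minInfPriority_eq (Filter.frequently_atTop.2 fun a => ?_)
      (.of_forall fun n => hM _ (by omega))
    obtain ⟨b, hb, hbk⟩ := Filter.frequently_atTop.1 h1 (N + a)
    exact ⟨b - N, by omega, by rwa [Nat.add_sub_cancel' (by omega)]⟩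
  have he : G.EvenWins (fun n => π (N + n)) := by rwa [EvenWins, hk]
  refine ⟨N, fun x => ?_⟩
  rw [G.value_of_evenWins he]
  induction x using WithTop.recTopCoe with
  | top => exact le_top
  | coe α =>
    refine coe_toLex_mono (g := ofLex α) fun i => ?_
    dsimp only
    split_ifs with hi
    · have : G.dominatedTimes (fun n => π (N + n)) i = ∅ := by
        refine Set.eq_empty_of_forall_notMem fun n hn => ?_
        have h0 : (i : ℕ) ≤ G.minInfPriority π := hNk ▸ hn.2 0 n.zero_le
        have h3 : G.minInfPriority π ≤ i := hn.1 ▸ hM (N + n) (by omega)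
        rw [EvenWins, ← le_antisymm h0 h3] at h
        exact Nat.not_even_iff_odd.2 hi h
      rw [this]
      simp
    · exact Nat.zero_le _

/-- If the least recurring priority `k` were odd, the truncations of `ρ n` at `k` would eventually
never increase and would drop strictly at each visit to `k`, against well-foundedness. Finiteness
passes on from `ρ 0`, since `⊤` is fixed by backup. -/
theorem evenWins_of_backup_le {π : ℕ → V} {ρ : ℕ → MTuple G.dim}
    (h : ∀ n, backup (G.priority (π n)) (ρ (n + 1)) ≤ ρ n) (h0 : ρ 0 ≠ ⊤) : G.EvenWins π := by
  have hfin : ∀ n, ρ n ≠ ⊤ := by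
    intro n
    induction n with
    | zero => exact h0
    | succ n ih =>
      intro hn
      have := h n
      rw [hn, backup_top, top_le_iff] at this
      exact ih this
  by_contra hw
  rw [EvenWins, Nat.not_even_iff_odd] at hw
  obtain ⟨h1, h2⟩ := G.minInfPriority_spec π
  set k := G.minInfPriority π
  obtain ⟨N, hN⟩ := Filter.eventually_atTop.1 h2
  have hstep : ∀ n, N ≤ n → truncate k (ρ (n + 1)) ≤ truncate k (ρ n) := fun n hn => by
    rw [← truncate_truncate (hN n hn) (ρ (n + 1))]
    exact truncate_mono k ((truncate_le_backup _ _).trans (h n))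
  -- Take a time where the truncation is least; the next visit to `k` undercuts it.
  obtain ⟨_, ⟨n0, hn0, rfl⟩, hmin⟩ := wellFounded_lt.has_min
    ((fun n => truncate k (ρ n)) '' Set.Ici N) ⟨_, N, Set.mem_Ici.2 le_rfl, rfl⟩
  obtain ⟨n1, hn1, hk⟩ := Filter.frequently_atTop.1 h1 n0
  have hanti : ∀ n, n0 ≤ n → truncate k (ρ n) ≤ truncate k (ρ n0) := fun n hn => by
    induction n, hn using Nat.le_induction with
    | base => exact le_rfl
    | succ n hn ih => exact (hstep n (le_trans hn0 hn)).trans ih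
  refine hmin _ ⟨n1 + 1, Set.mem_Ici.2 (by have := Set.mem_Ici.1 hn0; omega), rfl⟩
    (lt_of_lt_of_le ?_ (hanti n1 hn1))
  have hb := h n1
  rw [hk] at hb
  exact (truncate_lt_backup hw (hk ▸ G.priority_lt_dim (π n1)) (hfin _)).trans_le
    ((backup_le_iff _ _ _).2 hb)

theorem value_le_of_backup_le {π : ℕ → V} {ρ : ℕ → MTuple G.dim}
    (h : ∀ n, backup (G.priority (π n)) (ρ (n + 1)) ≤ ρ n) : G.value π ≤ ρ 0 := by
  by_cases h0 : ρ 0 = ⊤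
  · rw [h0]; exact le_top
  obtain ⟨N, hN⟩ := G.exists_value_shift_le (G.evenWins_of_backup_le h h0)
  -- The bound at the tail from `N` is free; monotonicity of backup moves it back one vertex at a
  -- time.
  have hN' := hN (ρ N)
  clear hN h0
  induction N with
  | zero => simpa using hN'
  | succ N ih =>
    refine ih ?_
    rw [value_eq_backup]
    refine le_trans (backup_mono _ ?_) (h N)
    simpa only [add_assoc, add_comm 1] using hN'

end Values

end ParityGame

namespace ParityGame

open MTuple

/-! ### Removing loops dominated by an odd priority -/

section Loops

variable {V : Type*} (G : ParityGame V)

open Classical in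
/-- `cut u s` is the longest suffix of `s` that begins with `u`, if there is one and if no vertex
before it has a priority less than that of `u`. Histories are lists whose head is the most recent
vertex. -/
noncomputable def cut (u : V) : List V → Option (List V)
  | [] => none
  | a :: s => if a = u then some (a :: s) else if G.priority u ≤ G.priority a then cut u s else none

open Classical in
/-- Extend the history `s` by `u`, and remove the loop that this closes if the least priority in the
loop is odd and is that of `u`. -/
noncomputable def push (s : List V) (u : V) : List V :=
  if Odd (G.priority u) then (G.cut u s).getD (u :: s) else u :: s

/-- The history `l` (with the most recent vertex at the end), with all loops dominated by an odd
priority removed. The result has the most recent vertex at its head. -/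
noncomputable def reduce (l : List V) : List V := l.foldl G.push []

variable {G}

theorem cut_eq_some {u : V} {s s' : List V} (h : G.cut u s = some s') :
    ∃ t r, s = t ++ s' ∧ s' = u :: r ∧ ∀ a ∈ t, G.priority u ≤ G.priority a := by
  induction s with
  | nil => simp [cut] at h
  | cons a s ih =>
    rw [cut] at h
    split_ifs at h with h1 h2
    · obtain rfl := Option.some.inj h
      exact ⟨[], s, rfl, by rw [h1], by simp⟩
    · obtain ⟨t, r, rfl, h3, h4⟩ := ih h
      exact ⟨a :: t, r, rfl, h3, by simpa using ⟨h2, h4⟩⟩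

theorem cut_ne_none {u : V} {t r : List V} (h : ∀ a ∈ t, G.priority u ≤ G.priority a) :
    G.cut u (t ++ u :: r) ≠ none := by
  induction t with
  | nil => simp [cut]
  | cons a t ih =>
    rw [List.cons_append, cut]
    split_ifs with h1 h2
    · simp
    · exact ih fun b hb => h b (by simp [hb])
    · exact absurd (h a (by simp)) h2

/-- Either the vertex is added and closes no loop dominated by an odd priority, or a loop is
removed. -/
theorem push_cases (s : List V) (u : V) :
    (G.push s u = u :: s ∧ (Odd (G.priority u) → G.cut u s = none)) ∨
    (Odd (G.priority u) ∧ ∃ t r, s = t ++ u :: r ∧ G.push s u = u :: r ∧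
      ∀ a ∈ t, G.priority u ≤ G.priority a) := by
  by_cases ho : Odd (G.priority u)
  · cases h : G.cut u s with
    | none => exact Or.inl ⟨by simp [push, ho, h], fun _ => rfl⟩
    | some s' =>
      obtain ⟨t, r, h1, rfl, h3⟩ := cut_eq_some h
      exact Or.inr ⟨ho, t, r, h1, by simp [push, ho, h], h3⟩
  · exact Or.inl ⟨by simp [push, ho], fun h => absurd h ho⟩

theorem exists_push_eq_cons (s : List V) (u : V) : ∃ r, G.push s u = u :: r ∧ r <:+ s := by
  rcases G.push_cases s u with ⟨h, -⟩ | ⟨-, t, r, h1, h2, -⟩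
  · exact ⟨s, h, List.suffix_rfl⟩
  · exact ⟨r, h2, t ++ [u], by simp [h1]⟩

theorem length_push_le (s : List V) (u : V) : (G.push s u).length ≤ s.length + 1 := by
  obtain ⟨r, h1, h2⟩ := G.exists_push_eq_cons s u
  simpa [h1] using h2.length_le

theorem reduce_concat (l : List V) (u : V) : G.reduce (l ++ [u]) = G.push (G.reduce l) u := by
  simp [reduce]

theorem isChain_reduce {l : List V} (h : l.IsChain G.Edge) :
    (G.reduce l).IsChain (fun a b => G.Edge b a) := by
  induction l using List.reverseRecOn with
  | nil => simp [reduce]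
  | append_singleton l u ih =>
    have ih := ih h.left_of_append
    rw [reduce_concat]
    rcases G.push_cases (G.reduce l) u with ⟨h1, -⟩ | ⟨-, t, r, h1, h2, -⟩
    · rw [h1]
      rcases List.eq_nil_or_concat' l with rfl | ⟨l', a, rfl⟩
      · simp [reduce]
      · rw [reduce_concat] at ih ⊢
        obtain ⟨r, hr, -⟩ := G.exists_push_eq_cons (G.reduce l') a
        rw [hr] at ih ⊢
        refine List.isChain_cons_cons.2 ⟨?_, ih⟩
        rw [List.append_assoc, List.singleton_append, List.isChain_append_cons_cons] at h
        exact h.2.1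
    · rw [h2]
      exact ih.suffix ⟨t, h1.symm⟩

/-- The strategy that forgets the loops that are dominated by an odd priority. -/
noncomputable def Strategy.forgetLoops {p : Player} (σ : G.Strategy p) : G.Strategy p where
  move l := σ.move (G.reduce l).reverse
  legal := by
    intro l u w hl h
    have hc := List.isChain_reverse.2 (isChain_reduce hl)
    rw [reduce_concat] at h hc
    obtain ⟨r, hr, -⟩ := G.exists_push_eq_cons (G.reduce l) u
    rw [hr, List.reverse_cons] at h hc
    exact σ.legal _ _ _ hc h

variable (G) in
/-- The history of `π` at the time `n`, with the loops dominated by an odd priority removed. -/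
noncomputable def stack (π : ℕ → V) (n : ℕ) : List V := G.reduce ((List.range (n + 1)).map π)

theorem stack_zero (π : ℕ → V) : G.stack π 0 = [π 0] := by
  simp [stack, reduce, push, cut]

theorem stack_succ (π : ℕ → V) (n : ℕ) : G.stack π (n + 1) = G.push (G.stack π n) (π (n + 1)) := by
  rw [stack, List.range_succ, List.map_append, List.map_singleton, reduce_concat, stack]

theorem stack_eq_cons (π : ℕ → V) (n : ℕ) : ∃ r, G.stack π n = π n :: r := by
  rcases n with _ | n
  · exact ⟨[], stack_zero π⟩
  · obtain ⟨r, hr, -⟩ := G.exists_push_eq_cons (G.stack π n) (π (n + 1))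
    exact ⟨r, by rw [stack_succ, hr]⟩

theorem length_stack_pos (π : ℕ → V) (n : ℕ) : 0 < (G.stack π n).length := by
  obtain ⟨r, hr⟩ := G.stack_eq_cons π n
  simp [hr]

/-- A vertex is put on the stack only when it is the actual next move, which `σ` chose from that
very stack. Removing a loop leaves a suffix of the old stack, so no new adjacency arises. -/
theorem stack_consistent {p : Player} {σ : G.Strategy p} {v : V} {π : ℕ → V}
    (hπ : π ∈ G.plays σ.forgetLoops v) (n : ℕ) :
    ∀ a b r, (b :: a :: r) <:+ G.stack π n →
      G.Edge a b ∧ ∀ w, σ.move (a :: r).reverse = some w → b = w := by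
  induction n with
  | zero =>
    intro a b r h
    have := h.length_le
    simp [stack_zero] at this
  | succ n ih =>
    intro a b r h
    rw [stack_succ] at h
    rcases G.push_cases (G.stack π n) (π (n + 1)) with ⟨h1, -⟩ | ⟨-, t, r', h1, h2, -⟩
    · rw [h1, List.suffix_cons_iff] at h
      rcases h with h | h
      · obtain ⟨rfl, hs⟩ := List.cons.inj h
        obtain ⟨r', hr'⟩ := G.stack_eq_cons π n
        obtain ⟨rfl, -⟩ := List.cons.inj (hs.trans hr')
        refine ⟨hπ.1 n, fun w hw => hπ.2.2 n w ?_⟩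
        rw [hs] at hw
        exact hw
      · exact ih a b r h
    · rw [h2] at h
      exact ih a b r (h.trans ⟨t, h1.symm⟩)

/-- A forbidden loop could only be closed by a newly added head, but then `cut` would have found it
and removed it. -/
theorem stack_loop_free (π : ℕ → V) (n : ℕ) :
    ∀ u t r, (u :: (t ++ u :: r)) <:+ G.stack π n → Odd (G.priority u) →
      ∃ a ∈ t, G.priority a < G.priority u := by
  induction n with
  | zero =>
    intro u t r h
    have := h.length_le
    simp [stack_zero] at this
  | succ n ih =>
    intro u t r h ho
    rw [stack_succ] at h
    rcases G.push_cases (G.stack π n) (π (n + 1)) with ⟨h1, hc⟩ | ⟨-, t', r', h1, h2, -⟩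
    · rw [h1, List.suffix_cons_iff] at h
      rcases h with h | h
      · obtain ⟨rfl, h⟩ := List.cons.inj h
        by_contra! hcon
        exact cut_ne_none hcon (h ▸ hc ho)
      · exact ih u t r h ho
    · rw [h2] at h
      exact ih u t r (h.trans ⟨t', h1.symm⟩) ho

/-- As long as the reduced history is not shortened below its length at the time `N`, it keeps its
part from that time, and its vertices since then bound the priorities that have been seen. -/
theorem stack_stable {π : ℕ → V} {N : ℕ} {u : V} {c : List V} (hN : G.stack π N = u :: c)
    {n : ℕ} (hn : N ≤ n) (h : ∀ m, N ≤ m → m ≤ n → c.length < (G.stack π m).length) :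
    ∃ t, G.stack π n = t ++ u :: c ∧
      ∀ m, N ≤ m → m ≤ n → ∃ a ∈ t ++ [u], G.priority a ≤ G.priority (π m) := by
  induction n, hn using Nat.le_induction with
  | base =>
    refine ⟨[], hN, fun m h1 h2 => ⟨u, by simp, ?_⟩⟩
    obtain rfl := le_antisymm h1 h2
    obtain ⟨r, hr⟩ := G.stack_eq_cons π N
    rw [hr] at hN
    rw [(List.cons.inj hN).1]
  | succ n hn ih =>
    obtain ⟨t, ht, hm⟩ := ih fun m h1 h2 => h m h1 (by omega)
    rcases G.push_cases (G.stack π n) (π (n + 1)) with ⟨h1, -⟩ | ⟨-, t', r, h1, h2, h3⟩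
    · refine ⟨π (n + 1) :: t, by rw [stack_succ, h1, ht]; rfl, fun m hm1 hm2 => ?_⟩
      rcases hm2.lt_or_eq with hm2 | rfl
      · obtain ⟨a, ha, hle⟩ := hm m hm1 (by omega)
        exact ⟨a, by simp at ha ⊢; tauto, hle⟩
      · exact ⟨π (n + 1), by simp, le_rfl⟩
    · have hlen := h (n + 1) (by omega) le_rfl
      rw [stack_succ, h2] at hlen
      -- Both are suffixes of the stack at time `n`; the length bound makes the old part the shorter
      -- one. The removed vertices are still bounded by the retained `π (n + 1)`, whose priority is
      -- at most theirs.
      obtain ⟨t1, ht1⟩ : (u :: c) <:+ (π (n + 1) :: r) :=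
        List.suffix_of_suffix_length_le ⟨t, ht.symm⟩ ⟨t', h1.symm⟩ (by simpa using hlen)
      have hmem : π (n + 1) ∈ t1 ++ [u] := by
        rcases t1 with _ | ⟨b, t1⟩
        · simp [(List.cons.inj ht1).1]
        · simp [(List.cons.inj ht1).1]
      have htt : t = t' ++ t1 := by
        rw [ht, ← ht1, ← List.append_assoc] at h1
        exact List.append_cancel_right h1
      refine ⟨t1, by rw [stack_succ, h2, ht1], fun m hm1 hm2 => ?_⟩
      rcases hm2.lt_or_eq with hm2 | rfl
      · obtain ⟨a, ha, hle⟩ := hm m hm1 (by omega)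
        rw [htt, List.append_assoc, List.mem_append] at ha
        rcases ha with ha | ha
        · exact ⟨_, hmem, (h3 a ha).trans hle⟩
        · exact ⟨a, ha, hle⟩
      · exact ⟨_, hmem, le_rfl⟩

/-- If loops are removed forever down to bounded histories, then player `odd` wins. -/
theorem not_evenWins_of_frequently_short {π : ℕ → V} {L : ℕ}
    (h : ∃ᶠ n in Filter.atTop, (G.stack π n).length < L) : ¬ G.EvenWins π := by
  classical
  have hex : ∃ L, ∃ᶠ n in Filter.atTop, (G.stack π n).length < L := ⟨L, h⟩
  -- With the least such `L`, the length is eventually at least `L - 1` and infinitely often equal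
  -- to it. At those times the stack is always the same, and its head has the least priority seen
  -- since the first of them.
  have hL := Nat.find_spec hex
  have hmin : ∀ᶠ n in Filter.atTop, Nat.find hex ≤ (G.stack π n).length + 1 := by
    rcases hc : Nat.find hex with _ | l
    · exact .of_forall fun n => Nat.zero_le _
    · have := Nat.find_min hex (m := l) (by omega)
      rw [Filter.not_frequently] at this
      exact this.mono fun n hn => by omega
  set L := Nat.find hex
  obtain ⟨M, hM⟩ := Filter.eventually_atTop.1 hmin
  obtain ⟨N, hMN, hNL⟩ := Filter.frequently_atTop.1 hL M
  obtain ⟨c, hc⟩ := G.stack_eq_cons π N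
  have hcl : c.length + 2 = L := by
    have := hM N hMN
    rw [hc, List.length_cons] at this hNL
    omega
  have key : ∀ n, N ≤ n → (G.stack π n).length < L → G.stack π n = π N :: c ∧
      ∀ m, N ≤ m → m ≤ n → G.priority (π N) ≤ G.priority (π m) := by
    intro n hn hl
    obtain ⟨t, ht, hp⟩ := stack_stable hc hn fun m h1 h2 => by
      have := hM m (by omega)
      omega
    obtain rfl : t = [] := by
      rw [ht, List.length_append, List.length_cons] at hl
      exact List.eq_nil_of_length_eq_zero (by omega)
    exact ⟨ht, by simpa using hp⟩
  have heq : ∀ n, N ≤ n → (G.stack π n).length < L → π n = π N := by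
    intro n hn hl
    obtain ⟨r, hr⟩ := G.stack_eq_cons π n
    exact (List.cons.inj (hr.symm.trans (key n hn hl).1)).1
  have hmi : G.minInfPriority π = G.priority (π N) := by
    refine G.minInfPriority_eq (Filter.frequently_atTop.2 fun a => ?_)
      (Filter.eventually_atTop.2 ⟨N, fun m hm => ?_⟩)
    · obtain ⟨n, hn, hl⟩ := Filter.frequently_atTop.1 hL (max a N)
      exact ⟨n, le_trans (le_max_left _ _) hn,
        by rw [heq n (le_trans (le_max_right _ _) hn) hl]⟩
    · obtain ⟨n, hn, hl⟩ := Filter.frequently_atTop.1 hL (max m N)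
      exact (key n (le_trans (le_max_right _ _) hn) hl).2 m hm (le_trans (le_max_left _ _) hn)
  obtain ⟨n, hn, hl⟩ := Filter.frequently_atTop.1 hL (N + 1)
  obtain ⟨n, rfl⟩ : ∃ n', n = n' + 1 := ⟨n - 1, by omega⟩
  -- The length `L - 1` cannot be reached by adding a vertex, as the stack would have been too short
  -- before. So a loop was removed, and its priority is odd.
  have hodd : Odd (G.priority (π (n + 1))) := by
    rcases G.push_cases (G.stack π n) (π (n + 1)) with ⟨h1, -⟩ | ⟨ho, -⟩
    · rw [stack_succ, h1, List.length_cons] at hl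
      have := hM n (by omega)
      omega
    · exact ho
  rw [heq _ (by omega) hl] at hodd
  rw [EvenWins, hmi]
  exact Nat.not_even_iff_odd.2 hodd

/-- If the reduced histories grow, they converge to a play: `T i` is the time at which its vertex
at the position `i` is added for good. -/
theorem exists_limit_times {π : ℕ → V}
    (h : ∀ L, ∀ᶠ n in Filter.atTop, L ≤ (G.stack π n).length) :
    ∃ T : ℕ → ℕ, StrictMono T ∧ T 0 = 0 ∧
      (∀ i, G.stack π (T i) = ((List.range (i + 1)).map (π ∘ T)).reverse) ∧
      ∀ i, ∀ m ≤ T i, ∃ j ≤ i, G.priority (π (T j)) ≤ G.priority (π m) := by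
  classical
  have hex : ∀ i, ∃ N, ∀ n, N ≤ n → i + 1 ≤ (G.stack π n).length := fun i =>
    Filter.eventually_atTop.1 (h (i + 1))
  -- `T i` is the first time from which the length stays at least `i + 1`. Just before a positive `T
  -- i` the length is at most `i`, and a push adds at most one, so at `T i` it is exactly `i + 1`.
  set T : ℕ → ℕ := fun i => Nat.find (hex i) with hT
  have hspec : ∀ i n, T i ≤ n → i + 1 ≤ (G.stack π n).length := fun i => Nat.find_spec (hex i)
  have hT0 : T 0 = 0 := (Nat.find_eq_zero _).2 fun n _ => length_stack_pos π n
  have hlen : ∀ i, (G.stack π (T i)).length = i + 1 := by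
    intro i
    refine le_antisymm ?_ (hspec i _ le_rfl)
    rcases hTi : T i with _ | m
    · simp [stack_zero]
    · have hm := Nat.find_min (hex i) (m := m) (by change m < T i; omega)
      have hlt : (G.stack π m).length < i + 1 := by
        by_contra hcon
        refine hm fun n hn => ?_
        rcases hn.eq_or_lt with rfl | hn
        · omega
        · exact hspec i n (by omega)
      rw [stack_succ]
      exact (length_push_le _ _).trans hlt
  have hmono : StrictMono T := by
    refine strictMono_nat_of_lt_succ fun i => ?_
    have hle : T i ≤ T (i + 1) := Nat.find_mono fun N hN n hn => by
      have := hN n hn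
      omega
    refine hle.lt_of_ne fun he => ?_
    have := hlen i
    rw [he, hlen] at this
    omega
  have hstack : ∀ i, G.stack π (T i) = ((List.range (i + 1)).map (π ∘ T)).reverse := by
    intro i
    induction i with
    | zero => simp [hT0, stack_zero]
    | succ i ih =>
      obtain ⟨c, hc⟩ := G.stack_eq_cons π (T i)
      have hl := hlen i
      rw [hc, List.length_cons] at hl
      obtain ⟨t, ht, -⟩ := stack_stable hc (hmono i.lt_succ_self).le fun m hm _ => by
        have := hspec i m hm
        omega
      have hl' := hlen (i + 1)
      obtain ⟨r, hr⟩ := G.stack_eq_cons π (T (i + 1))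
      rw [ht, List.length_append, List.length_cons] at hl'
      obtain ⟨a, rfl⟩ := List.length_eq_one_iff.1 (show t.length = 1 by omega)
      rw [ht, List.singleton_append] at hr
      rw [ht, ← hc, (List.cons.inj hr).1, ih, List.range_succ (n := i + 1), List.map_append,
        List.reverse_append]
      rfl
  refine ⟨T, hmono, hT0, hstack, fun i m hm => ?_⟩
  -- Applied from time `0`, with nothing below the initial vertex, stability bounds all priorities
  -- seen so far by those on the stack.
  obtain ⟨t, ht, hp⟩ := stack_stable (stack_zero π) (Nat.zero_le (T i))
    fun m _ _ => length_stack_pos π m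
  obtain ⟨a, ha, hle⟩ := hp m m.zero_le hm
  rw [← ht, hstack i, List.mem_reverse, List.mem_map] at ha
  obtain ⟨j, hj, rfl⟩ := ha
  exact ⟨j, Nat.lt_succ_iff.1 (List.mem_range.1 hj), hle⟩

end Loops

end ParityGame

namespace ParityGame

open MTuple

/-! ### Values of the limit plays -/

section LoopFree

variable {V : Type*} [Fintype V] {G : ParityGame V}

/-- The value of a play without loops dominated by an odd priority is a measure, and player `even`
wins such a play. -/
theorem value_mem_measures_of_loop_free {π : ℕ → V}
    (h : ∀ i j, i < j → π i = π j → Odd (G.priority (π i)) →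
      ∃ m, i < m ∧ m < j ∧ G.priority (π m) < G.priority (π i)) :
    G.EvenWins π ∧ G.value π ∈ G.measures := by
  -- Two visits to one vertex of odd priority `k` must be separated by a smaller priority. This is
  -- used with late `N` to exclude an odd winner, and with `N = 0` to bound each degree by the
  -- number of vertices.
  have hinj : ∀ s : Set ℕ, ∀ k N, Odd k → (∀ n ∈ s, N ≤ n ∧ G.priority (π n) = k ∧
      ∀ m, N ≤ m → m ≤ n → k ≤ G.priority (π m)) → Set.InjOn π s := by
    intro s k N hk hs
    have hlt : ∀ i ∈ s, ∀ j ∈ s, i < j → π i ≠ π j := by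
      intro i hi j hj hij he
      obtain ⟨hi0, hi1, -⟩ := hs i hi
      obtain ⟨m, hm1, hm2, hm3⟩ := h i j hij he (hi1 ▸ hk)
      have := (hs j hj).2.2 m (by omega) hm2.le
      omega
    intro i hi j hj he
    rcases lt_trichotomy i j with hij | hij | hij
    · exact absurd he (hlt i hi j hj hij)
    · exact hij
    · exact absurd he.symm (hlt j hj i hi hij)
  have hE : G.EvenWins π := by
    by_contra hodd
    rw [EvenWins, Nat.not_even_iff_odd] at hodd
    obtain ⟨h1, h2⟩ := G.minInfPriority_spec π
    obtain ⟨N, hN⟩ := Filter.eventually_atTop.1 h2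
    have hinf := Nat.frequently_atTop_iff_infinite.1
      (h1.and_eventually (Filter.eventually_ge_atTop N))
    refine Set.not_injOn_infinite_finite_image hinf (Set.toFinite _)
      (hinj _ _ N hodd fun n hn => ⟨hn.2, hn.1, fun m hm _ => hN m hm⟩)
  refine ⟨hE, fun α hα i => ?_⟩
  rw [G.value_of_evenWins hE, WithTop.coe_inj] at hα
  subst hα
  constructor
  · intro he
    simp [Nat.not_odd_iff_even.2 he]
  · intro ho
    simp only [ofLex_toLex, if_pos ho]
    rw [numPriority, ← Set.ncard_coe_finset]
    refine Set.ncard_le_ncard_of_injOn π (fun n hn => ?_)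
      (hinj _ i 0 ho fun n hn => ⟨n.zero_le, hn.1, fun m _ hm => hn.2 m hm⟩)
    simpa using hn.1

/-- The injection on dominated times compares the values component by component; if odd wins `π`,
its value is `⊤`. -/
theorem value_le_value {π π' : ℕ → V} (h' : G.EvenWins π')
    (h : G.EvenWins π → ∃ T : ℕ → ℕ, T.Injective ∧
      ∀ k, Odd k → ∀ i ∈ G.dominatedTimes π' k, T i ∈ G.dominatedTimes π k) :
    G.value π' ≤ G.value π := by
  by_cases hE : G.EvenWins π
  · obtain ⟨T, hT, hd⟩ := h hE
    rw [G.value_of_evenWins hE, G.value_of_evenWins h']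
    refine coe_toLex_mono fun i => ?_
    dsimp only
    split_ifs with ho
    · exact Set.ncard_le_ncard_of_injOn T (hd i ho) hT.injOn (G.finite_dominatedTimes hE ho)
    · exact le_rfl
  · rw [G.value_of_not_evenWins hE]
    exact le_top

/-- A play that follows a strategy with loops removed is at least as good for player `odd` as some
play of the strategy the value of which is a measure. -/
theorem exists_measure_le_value {σ : G.Strategy Player.odd} {v : V} {x : MTuple G.dim}
    (hσ : ∀ π ∈ G.plays σ v, x ≤ G.value π) {π : ℕ → V} (hπ : π ∈ G.plays σ.forgetLoops v) :
    ∃ y ∈ G.measures, x ≤ y ∧ y ≤ G.value π := by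
  by_cases hL : ∀ L, ∀ᶠ n in Filter.atTop, L ≤ (G.stack π n).length
  · obtain ⟨T, hmono, hT0, hstack, hmin⟩ := exists_limit_times hL
    have hcons : ∀ n, G.Edge (π (T n)) (π (T (n + 1))) ∧ ∀ w,
        σ.move ((List.range (n + 1)).map (π ∘ T)) = some w → π (T (n + 1)) = w := by
      intro n
      have hs : G.stack π (T (n + 1)) =
          π (T (n + 1)) :: π (T n) :: ((List.range n).map (π ∘ T)).reverse := by
        simp [hstack, List.range_succ]
      obtain ⟨h1, h2⟩ := stack_consistent hπ (T (n + 1)) _ _ _ ⟨[], hs.symm⟩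
      refine ⟨h1, fun w hw => h2 w ?_⟩
      simpa [List.range_succ] using hw
    have hplay : π ∘ T ∈ G.plays σ v :=
      ⟨fun n => (hcons n).1, by simp [hT0, hπ.2.1], fun n => (hcons n).2⟩
    have hfree : ∀ i j, i < j → (π ∘ T) i = (π ∘ T) j → Odd (G.priority ((π ∘ T) i)) →
        ∃ m, i < m ∧ m < j ∧ G.priority ((π ∘ T) m) < G.priority ((π ∘ T) i) := by
      intro i j hij he ho
      obtain ⟨l, rfl⟩ : ∃ l, j = i + 1 + l := ⟨j - (i + 1), by omega⟩
      -- The stack at the time of the second visit, split at the position of the first.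
      have hs : G.stack π (T (i + 1 + l)) = (π ∘ T) i ::
          (((List.range l).map fun m => (π ∘ T) (i + 1 + m)).reverse ++
            (π ∘ T) i :: ((List.range i).map (π ∘ T)).reverse) := by
        rw [hstack, List.range_succ, List.map_append, List.reverse_append, List.range_add,
          List.map_append, List.reverse_append, List.range_succ, List.map_append,
          List.reverse_append, List.map_map, List.map_singleton, ← he]
        rfl
      obtain ⟨a, ha, hlt⟩ := stack_loop_free π _ _ _ _ ⟨[], hs.symm⟩ ho
      rw [List.mem_reverse, List.mem_map] at ha
      obtain ⟨m, hm, rfl⟩ := ha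
      rw [List.mem_range] at hm
      exact ⟨i + 1 + m, by omega, by omega, hlt⟩
    obtain ⟨hE, hmem⟩ := value_mem_measures_of_loop_free hfree
    refine ⟨_, hmem, hσ _ hplay, value_le_value hE fun _ =>
      ⟨T, hmono.injective, fun k _ i hi => ⟨hi.1, fun m hm => ?_⟩⟩⟩
    obtain ⟨j, hj, hle⟩ := hmin i m hm
    exact (hi.2 j hj).trans hle
  · push Not at hL
    obtain ⟨L, hL⟩ := hL
    exact ⟨⊤, G.top_mem_measures, le_top,
      (G.value_of_not_evenWins (not_evenWins_of_frequently_short hL)).ge⟩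

end LoopFree

/-! ### Composing strategies and playing them against each other -/

section Strategies

variable {V : Type*} {G : ParityGame V}

/-- The strategy that makes the move `first`, if there is one, from the initial vertex `v`, and
then plays the strategy `τ w` from the vertex `w` that has been reached. -/
noncomputable def Strategy.prepend {p : Player} (v : V) (first : Option V)
    (hfirst : ∀ w, first = some w → G.owner v = p ∧ G.Edge v w) (τ : V → G.Strategy p) :
    G.Strategy p where
  move
    | [] => none
    | [a] => open Classical in if a = v then first else none
    | _ :: b :: l => (τ b).move (b :: l)
  legal := by
    intro l u w hl h
    rcases l with _ | ⟨a, _ | ⟨b, l⟩⟩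
    · simp only [List.nil_append] at h
      split_ifs at h with hu
      exact hu ▸ hfirst w h
    · exact (τ u).legal [] u w (by simp) h
    · exact (τ b).legal (b :: l) u w hl.tail h

theorem map_range_succ (π : ℕ → V) (n : ℕ) :
    (List.range (n + 1)).map π = π 0 :: (List.range n).map fun m => π (m + 1) := by
  rw [List.range_succ_eq_map, List.map_cons, List.map_map]
  rfl

theorem mem_plays_prepend {p : Player} {v : V} {first : Option V}
    {hfirst : ∀ w, first = some w → G.owner v = p ∧ G.Edge v w} {τ : V → G.Strategy p}
    {π : ℕ → V} (hπ : π ∈ G.plays (Strategy.prepend v first hfirst τ) v) :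
    (∀ w, first = some w → π 1 = w) ∧ (fun n => π (n + 1)) ∈ G.plays (τ (π 1)) (π 1) := by
  obtain ⟨h1, h2, h3⟩ := hπ
  refine ⟨fun w hw => h3 0 w ?_, fun n => h1 (n + 1), rfl, fun n w hw => h3 (n + 1) w ?_⟩
  · simpa [Strategy.prepend, h2] using hw
  · rw [map_range_succ] at hw
    rw [map_range_succ, map_range_succ]
    exact hw

/-- Two strategies of the opponents have a common play. -/
theorem exists_mem_plays (σ : G.Strategy Player.odd) (τ : G.Strategy Player.even) (v : V) :
    ∃ π, π ∈ G.plays σ v ∧ π ∈ G.plays τ v := by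
  -- On a path at most one strategy is defined, since the last vertex has one owner; if neither is,
  -- totality supplies a move. Legality is only known on paths, hence the conditional form.
  have hnext : ∀ (l : List V) (u : V), ∃ w, (l ++ [u]).IsChain G.Edge → G.Edge u w ∧
      (∀ w', σ.move (l ++ [u]) = some w' → w = w') ∧
      ∀ w', τ.move (l ++ [u]) = some w' → w = w' := by
    intro l u
    by_cases hl : (l ++ [u]).IsChain G.Edge
    · rcases hs : σ.move (l ++ [u]) with _ | w
      · rcases ht : τ.move (l ++ [u]) with _ | w
        · obtain ⟨w, hw⟩ := G.total u
          exact ⟨w, fun _ => ⟨hw, by simp, by simp⟩⟩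
        · exact ⟨w, fun _ => ⟨(τ.legal l u w hl ht).2, by simp, by simp⟩⟩
      · refine ⟨w, fun _ => ⟨(σ.legal l u w hl hs).2, by simp, fun w' ht => ?_⟩⟩
        have := (τ.legal l u w' hl ht).1
        rw [(σ.legal l u w hl hs).1] at this
        exact absurd this (by simp)
    · exact ⟨u, fun h => absurd h hl⟩
  choose next hnext using hnext
  let st : ℕ → List V × V := fun n =>
    Nat.rec ([], v) (fun _ s => (s.1 ++ [s.2], next s.1 s.2)) n
  have hst : ∀ n, (st n).1 = (List.range n).map fun m => (st m).2 := by
    intro n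
    induction n with
    | zero => rfl
    | succ n ih =>
      rw [List.range_succ, List.map_append, ← ih]
      rfl
  have hst' : ∀ n, (st n).1 ++ [(st n).2] = (List.range (n + 1)).map fun m => (st m).2 :=
    fun n => hst (n + 1)
  have hchain : ∀ n, ((st n).1 ++ [(st n).2]).IsChain G.Edge := by
    intro n
    induction n with
    | zero => exact List.isChain_singleton _
    | succ n ih =>
      change ((st n).1 ++ [(st n).2] ++ [next (st n).1 (st n).2]).IsChain G.Edge
      rw [List.append_assoc, List.singleton_append, List.isChain_append_cons_cons]
      exact ⟨ih, (hnext _ _ ih).1, List.isChain_singleton _⟩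
  refine ⟨fun n => (st n).2, ⟨fun n => (hnext _ _ (hchain n)).1, rfl, fun n w hw => ?_⟩,
    ⟨fun n => (hnext _ _ (hchain n)).1, rfl, fun n w hw => ?_⟩⟩
  · rw [← hst'] at hw
    exact (hnext _ _ (hchain n)).2.1 w hw
  · rw [← hst'] at hw
    exact (hnext _ _ (hchain n)).2.2 w hw

end Strategies

/-! ### What player odd can force is a progress measure -/

section Valuation

variable {V : Type*} [Fintype V] (G : ParityGame V)

/-- Player `odd` can force the value of the play from `v` to be at least `x`. -/
def OddForces (v : V) (x : MTuple G.dim) : Prop :=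
  ∃ σ : G.Strategy Player.odd, ∀ π ∈ G.plays σ v, x ≤ G.value π

variable {G}

theorem OddForces.backup_of_odd {v w : V} {x : MTuple G.dim} (hv : G.owner v = Player.odd)
    (hvw : G.Edge v w) (h : G.OddForces w x) : G.OddForces v (backup (G.priority v) x) := by
  obtain ⟨τ, hτ⟩ := h
  refine ⟨Strategy.prepend v (some w) (fun w' h => Option.some.inj h ▸ ⟨hv, hvw⟩) fun _ => τ,
    fun π hπ => ?_⟩
  obtain ⟨h1, h2⟩ := mem_plays_prepend hπ
  rw [h1 w rfl] at h2
  rw [value_eq_backup, hπ.2.1]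
  exact backup_mono _ (hτ _ h2)

/-- Meant for vertices of player even: odd waits for the move and then continues with the strategy
for the vertex reached. -/
theorem oddForces_of_forall {v : V} {x : MTuple G.dim} {f : V → MTuple G.dim}
    (hf : ∀ w, G.OddForces w (f w)) (hx : ∀ w, G.Edge v w → x ≤ backup (G.priority v) (f w)) :
    G.OddForces v x := by
  choose τ hτ using hf
  refine ⟨Strategy.prepend v none (by simp) τ, fun π hπ => ?_⟩
  have hE : G.Edge v (π 1) := hπ.2.1 ▸ hπ.1 0
  rw [value_eq_backup, hπ.2.1]
  exact (hx _ hE).trans (backup_mono _ (hτ _ _ (mem_plays_prepend hπ).2))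

theorem oddForces_zero (v : V) :
    G.OddForces v ((toLex (0 : Fin G.dim → ℕ) : Lex (Fin G.dim → ℕ)) : MTuple G.dim) := by
  refine ⟨⟨fun _ => none, by simp⟩, fun π _ => ?_⟩
  rcases h : G.value π with _ | α
  · exact le_top
  · exact coe_toLex_mono (g := ofLex α) fun i => Nat.zero_le _

/-- What player `odd` can force is determined by the measures that player `odd` can force. -/
theorem OddForces.exists_measure {v : V} {x : MTuple G.dim} (h : G.OddForces v x) :
    ∃ y ∈ G.measures, x ≤ y ∧ G.OddForces v y := by
  obtain ⟨σ, hσ⟩ := h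
  have hne : {y | y ∈ G.measures ∧ x ≤ y}.Nonempty := ⟨⊤, G.top_mem_measures, le_top⟩
  -- The intermediate measure depends on the play, but the least measure above `x` is below all of
  -- them, so one `y` serves for every play.
  obtain ⟨y, ⟨hy, hxy⟩, hmin⟩ := wellFounded_lt.has_min _ hne
  refine ⟨y, hy, hxy, σ.forgetLoops, fun π hπ => ?_⟩
  obtain ⟨z, hz, hxz, hzπ⟩ := exists_measure_le_value hσ hπ
  exact (not_lt.1 (hmin z ⟨hz, hxz⟩)).trans hzπ

variable (G) in
/-- The greatest measures that player `odd` can force form a progress measure. -/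
theorem exists_progressMeasure_oddForces :
    ∃ ν : V → MTuple G.dim, G.IsProgressMeasure ν ∧ ∀ v, G.OddForces v (ν v) := by
  have hmax : ∀ v, ∃ m, (m ∈ G.measures ∧ G.OddForces v m) ∧
      ∀ m', m' ∈ G.measures ∧ G.OddForces v m' → m' ≤ m := fun v =>
    Set.exists_max_image {m | m ∈ G.measures ∧ G.OddForces v m} id
      (G.finite_measures.subset fun m hm => hm.1)
      ⟨_, fun α hα i => by
        rw [← WithTop.coe_inj.1 hα]
        exact ⟨fun _ => rfl, fun _ => Nat.zero_le _⟩, oddForces_zero v⟩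
  choose ν hν hmax using hmax
  have hle : ∀ v x, G.OddForces v x → x ≤ ν v := fun v x hx => by
    obtain ⟨y, hy, hxy, hyf⟩ := hx.exists_measure
    exact hxy.trans (hmax v y ⟨hy, hyf⟩)
  refine ⟨ν, G.isProgressMeasure_iff.2
    ⟨fun v => (hν v).1, fun v => ⟨fun _ => ?_, fun ho w hw => ?_⟩⟩,
    fun v => (hν v).2⟩
  -- Whatever even does, odd secures the smallest backup over the successors; a successor attaining
  -- it witnesses progress.
  · obtain ⟨w, hw, hmin⟩ := Set.exists_min_image {w | G.Edge v w}
      (fun w => backup (G.priority v) (ν w)) (Set.toFinite _) (G.total v)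
    exact ⟨w, hw, hle v _ (oddForces_of_forall (fun w => (hν w).2) hmin)⟩
  · exact hle v _ ((hν w).2.backup_of_odd ho hw)

variable (G) in
/-- A progress measure bounds the values that a positional strategy of player `even` secures. -/
theorem IsProgressMeasure.exists_positionalStrategy {ρ : V → MTuple G.dim}
    (hρ : G.IsProgressMeasure ρ) : ∃ σ : G.PositionalStrategy Player.even,
      ∀ v, ∀ π ∈ G.plays σ.toStrategy v, G.value π ≤ ρ v := by
  obtain ⟨-, hρ⟩ := G.isProgressMeasure_iff.1 hρ
  choose f hf using fun v => (hρ v).1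
  refine ⟨⟨fun u => f u.1 u.2, fun u => (hf u.1 u.2).1⟩, fun v π ⟨h1, h2, h3⟩ => ?_⟩
  have := G.value_le_of_backup_le (π := π) (ρ := fun n => ρ (π n)) fun n => by
    cases ho : G.owner (π n) with
    | even =>
      rw [h3 n (f (π n) ho) (by simp [PositionalStrategy.toStrategy, List.range_succ, ho])]
      exact (hf _ ho).2
    | odd => exact (hρ _).2 ho _ (h1 n)
  rwa [h2] at this

end Valuation

end ParityGame

/-! ### The equilibrium -/

open ParityGame in
theorem mainTheorem3 {V : Type*} [Fintype V] (G : ParityGame V) (ρ : V → MTuple G.dim)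
    (hρ : IsLeast {ρ' : V → MTuple G.dim | G.IsProgressMeasure ρ'} ρ) (v : V) :
    (∃ σ : G.Strategy Player.odd, ∀ π ∈ G.plays σ v, ρ v ≤ G.value π) ∧
    (∃ σ : G.PositionalStrategy Player.even,
      ∀ π ∈ G.plays σ.toStrategy v, G.value π ≤ ρ v) ∧
    IsGreatest {x | x ∈ G.extMeasures ∧
      ∃ σ : G.Strategy Player.odd, ∀ π ∈ G.plays σ v, x ≤ G.value π} (ρ v) ∧
    IsLeast {x | x ∈ G.extMeasures ∧
      ∃ σ : G.Strategy Player.even, ∀ π ∈ G.plays σ v, G.value π ≤ x} (ρ v) := by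
  obtain ⟨ν, hν, hforces⟩ := G.exists_progressMeasure_oddForces
  obtain ⟨σ, hσ⟩ := hforces v
  -- Leastness of `ρ` enters only here, through `ρ ≤ ν`.
  replace hσ : ∀ π ∈ G.plays σ v, ρ v ≤ G.value π := fun π hπ => (hρ.2 hν v).trans (hσ π hπ)
  obtain ⟨τ, hτ⟩ := IsProgressMeasure.exists_positionalStrategy G hρ.1
  have hmem : ρ v ∈ G.extMeasures := G.measures_subset_extMeasures (hρ.1.1 v)
  refine ⟨⟨σ, hσ⟩, ⟨τ, hτ v⟩, ⟨⟨hmem, σ, hσ⟩, ?_⟩, ⟨hmem, τ.toStrategy, hτ v⟩, ?_⟩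
  · rintro x ⟨-, σ', hσ'⟩
    -- The common play of a rival strategy and the opponent's optimal one bounds `x` by `ρ v`.
    obtain ⟨π, h1, h2⟩ := exists_mem_plays σ' τ.toStrategy v
    exact (hσ' π h1).trans (hτ v π h2)
  · rintro x ⟨-, τ', hτ'⟩
    obtain ⟨π, h1, h2⟩ := exists_mem_plays σ τ' v
    exact (hσ π h1).trans (hτ' π h2)
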